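/- Let $K$ be a field of characteristic $0$. The Riordan group $\mathcal R$ over $K$ is the group of all pairs $(d,h)$ of formal power series in $K[[x]]$ such that $d$ has order $0$ (that is, $d(0)\neq 0$) and $h$ has order $1$ (that is, $h(0)=0$ and the coefficient of $x$ in $h$ is nonzero), with the multiplication $$(d,h)(l,m)=\bigl(d\cdot l(h),\,m(h)\bigr).$$ Equivalently, identifying $(d,h)$ with the infinite lower triangular matrix whose $(i,j)$ entry ($i,j\ge 0$) is the coefficient of $x^i$ in $d\,h^j$, it is the group of all such matrices under the usual matrix product. Let $\mathcal R^{(0)}=\mathcal R$, and for $n\geq 1$ let $\mathcal R^{(n)}=[\mathcal R^{(n-1)},\mathcal R^{(n-1)}]$ be the subgroup generated by all commutators $[a,b]=a^{-1}b^{-1}ab$ with $a,b\in\mathcal R^{(n-1)}$. Then for every integer $n\geq 1$, $$\mathcal R^{(n)}=\bigl\{(d,h)\in\mathcal R:\ d\in 1+x^{2^n-n}K[[x]],\ h\in x+x^{2^n}K[[x]]\bigr\},$$ and every element of $\mathcal R^{(n)}$ is a single commutator $[a,b]=a^{-1}b^{-1}ab$ of two elements $a,b\in\mathcal R^{(n-1)}$.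 -/

import Mathlib

/-- `(d, h)` with `d` a formal power series of order `0` and `h` a formal power series of
order `1`: an element of the Riordan group with entries in `K`. -/
@[ext]
structure Riordan (K : Type*) [Field K] where
  d : PowerSeries K
  h : PowerSeries K
  constantCoeff_d : PowerSeries.constantCoeff d ≠ 0
  constantCoeff_h : PowerSeries.constantCoeff h = 0
  coeff_one_h : PowerSeries.coeff 1 h ≠ 0

namespace Riordan

open PowerSeries

variable {K : Type*} [Field K]

theorem coeff_pow_of_lt {h : PowerSeries K} (hh : constantCoeff h = 0) {n k : ℕ} (hnk : n < k) :
    coeff n (h ^ k) = 0 := by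
  obtain ⟨B, rfl⟩ : X ∣ h := by rwa [X_dvd_iff]
  rw [mul_pow, coeff_X_pow_mul', if_neg (by omega)]

theorem coeff_subst_eq_sum {h : PowerSeries K} (hh : constantCoeff h = 0) (f : PowerSeries K)
    {n N : ℕ} (hN : n < N) :
    coeff n (f.subst h) = ∑ k ∈ Finset.range N, coeff n (h ^ k) * coeff k f := by
  rw [coeff_subst' (HasSubst.of_constantCoeff_zero' hh)]
  rw [finsum_eq_sum_of_support_subset (s := Finset.range N)]
  · simp [mul_comm]
  · intro k hk
    by_contra hk'
    apply hk
    have : n < k := by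
      simp at hk'
      omega
    simp [coeff_pow_of_lt hh this]

theorem constantCoeff_subst_eq {h : PowerSeries K} (hh : constantCoeff h = 0)
    (f : PowerSeries K) : constantCoeff (f.subst h : PowerSeries K) = constantCoeff f := by
  rw [← coeff_zero_eq_constantCoeff_apply, coeff_subst_eq_sum hh f (Nat.lt_succ_self 0)]
  simp

theorem coeff_one_subst_eq {h : PowerSeries K} (hh : constantCoeff h = 0)
    (f : PowerSeries K) : coeff 1 (f.subst h : PowerSeries K) = coeff 1 h * coeff 1 f := by
  rw [coeff_subst_eq_sum hh f (Nat.lt_succ_self 1)]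
  simp [Finset.sum_range_succ, coeff_one]

theorem hasSubst (p : Riordan K) : HasSubst p.h :=
  HasSubst.of_constantCoeff_zero' p.constantCoeff_h

/-- The identity `(1, x)`. -/
noncomputable instance : One (Riordan K) where
  one :=
    { d := 1
      h := X
      constantCoeff_d := by simp
      constantCoeff_h := by simp
      coeff_one_h := by simp }

/-- The product `(d, h)(l, m) = (d · l(h), m(h))`. -/
noncomputable instance : Mul (Riordan K) where
  mul p q :=
    { d := p.d * q.d.subst p.h
      h := q.h.subst p.h
      constantCoeff_d := by
        rw [map_mul, constantCoeff_subst_eq p.constantCoeff_h]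
        exact mul_ne_zero p.constantCoeff_d q.constantCoeff_d
      constantCoeff_h := by
        rw [constantCoeff_subst_eq p.constantCoeff_h, q.constantCoeff_h]
      coeff_one_h := by
        rw [coeff_one_subst_eq p.constantCoeff_h]
        exact mul_ne_zero p.coeff_one_h q.coeff_one_h }

/-- The inverse `(d, h)⁻¹ = (1 / d(h⁻¹), h⁻¹)`, where `h⁻¹` is the compositional inverse. -/
noncomputable instance : Inv (Riordan K) where
  inv p :=
    { d := (p.d.subst (p.h.substInvOfIsUnit p.coeff_one_h.isUnit) : PowerSeries K)⁻¹
      h := p.h.substInvOfIsUnit p.coeff_one_h.isUnit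
      constantCoeff_d := by
        rw [constantCoeff_inv, constantCoeff_subst_eq (constantCoeff_substInvOfIsUnit _ _)]
        exact inv_ne_zero p.constantCoeff_d
      constantCoeff_h := constantCoeff_substInvOfIsUnit _ _
      coeff_one_h := by
        rw [coeff_one_substInvOfIsUnit]
        exact Units.ne_zero _ }

theorem one_d : (1 : Riordan K).d = 1 := rfl

theorem one_h : (1 : Riordan K).h = X := rfl

theorem mul_d (p q : Riordan K) : (p * q).d = p.d * q.d.subst p.h := rfl

theorem mul_h (p q : Riordan K) : (p * q).h = q.h.subst p.h := rfl

theorem inv_d (p : Riordan K) : (p⁻¹).d = (p.d.subst (p⁻¹).h : PowerSeries K)⁻¹ := rfl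

theorem inv_h (p : Riordan K) : (p⁻¹).h = p.h.substInvOfIsUnit p.coeff_one_h.isUnit := rfl

noncomputable instance : Group (Riordan K) :=
  Group.ofLeftAxioms
    (by
      intro p q r
      ext1
      · simp only [mul_d, mul_h]
        rw [subst_mul p.hasSubst, subst_comp_subst_apply q.hasSubst p.hasSubst, mul_assoc]
      · simp only [mul_h]
        rw [subst_comp_subst_apply q.hasSubst p.hasSubst])
    (by
      intro p
      ext1
      · rw [mul_d, one_d, one_h, X_subst, one_mul]
      · rw [mul_h, one_h, X_subst])
    (by
      intro p
      ext1
      · rw [mul_d, inv_d, one_d]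
        refine PowerSeries.inv_mul_cancel _ ?_
        rw [constantCoeff_subst_eq (p⁻¹).constantCoeff_h]
        exact p.constantCoeff_d
      · rw [mul_h, inv_h, one_h]
        exact subst_substInvOfIsUnit_right p.h p.constantCoeff_h p.coeff_one_h.isUnit)

/-- The Riordan matrix of `(d, h)`: its `(i, j)` entry is the coefficient of `x ^ i`
in `d * h ^ j`. -/
noncomputable def toMatrix (p : Riordan K) : Matrix ℕ ℕ K :=
  Matrix.of fun i j => coeff i (p.d * p.h ^ j)

/-- Riordan matrices are lower triangular. -/
theorem toMatrix_of_lt (p : Riordan K) {i j : ℕ} (hij : i < j) : p.toMatrix i j = 0 := by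
  obtain ⟨B, hB⟩ : X ∣ p.h := by
    rw [X_dvd_iff]
    exact p.constantCoeff_h
  change coeff i (p.d * p.h ^ j) = 0
  rw [hB, mul_pow, mul_left_comm, coeff_X_pow_mul', if_neg (by omega)]

/-- The matrix of `(d, h)` determines `(d, h)`. -/
theorem toMatrix_injective : Function.Injective (toMatrix : Riordan K → Matrix ℕ ℕ K) := by
  intro p q hpq
  have key : ∀ j : ℕ, p.d * p.h ^ j = q.d * q.h ^ j := by
    intro j
    ext i
    exact congrFun (congrFun hpq i) j
  have hd : p.d = q.d := by simpa using key 0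
  have hne : q.d ≠ 0 := by
    intro h0
    apply q.constantCoeff_d
    simp [h0]
  ext1
  · exact hd
  · have h1 := key 1
    rw [hd, pow_one, pow_one] at h1
    exact mul_left_cancel₀ hne h1

theorem toMatrix_one : (1 : Riordan K).toMatrix = 1 := by
  ext i j
  change coeff i ((1 : PowerSeries K) * X ^ j) = _
  rw [one_mul, coeff_X_pow, Matrix.one_apply]

/-- The group law is the usual product of (infinite, lower triangular) matrices. -/
theorem toMatrix_mul (p q : Riordan K) (i j : ℕ) :
    (p * q).toMatrix i j = ∑ k ∈ Finset.range (i + 1), p.toMatrix i k * q.toMatrix k j := by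
  change coeff i ((p * q).d * (p * q).h ^ j) =
    ∑ k ∈ Finset.range (i + 1), coeff i (p.d * p.h ^ k) * coeff k (q.d * q.h ^ j)
  rw [mul_d, mul_h, ← subst_pow p.hasSubst, mul_assoc, ← subst_mul p.hasSubst, coeff_mul]
  have step : ∀ x ∈ Finset.HasAntidiagonal.antidiagonal i,
      coeff x.1 p.d * coeff x.2 ((q.d * q.h ^ j).subst p.h : PowerSeries K) =
        ∑ k ∈ Finset.range (i + 1),
          coeff x.1 p.d * coeff x.2 (p.h ^ k) * coeff k (q.d * q.h ^ j) := by
    intro x hx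
    have hx' : x.2 < i + 1 := by
      have := Finset.HasAntidiagonal.mem_antidiagonal.mp hx
      omega
    rw [coeff_subst_eq_sum p.constantCoeff_h _ hx', Finset.mul_sum]
    exact Finset.sum_congr rfl fun k _ => (mul_assoc _ _ _).symm
  rw [Finset.sum_congr rfl step, Finset.sum_comm]
  refine Finset.sum_congr rfl fun k _ => ?_
  rw [coeff_mul (n := i) (φ := p.d), Finset.sum_mul]

end Riordan

namespace Riordan

open PowerSeries
open scoped commutatorElement

variable {K : Type*} [Field K]

/-! Induction on `n`, with `s = 2 ^ n - 1` and `a = 2 ^ n - n`: passing to the next derived subgroup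
turns the orders `(a, s + 1)` into `(a + s, 2 * (s + 1))`.

Upper bound: if `p`, `q` have orders `(a, s + 1)` with `s ≥ 1`, then in each of `q.h(p.h)` and
`p.h(q.h)` the interaction begins with the same term, `s + 1` times the product of the two leading
coefficients, in degree `2 * s + 1`. It cancels, so `p * q` and `q * p` agree to the claimed order
(`congr_mul_comm_of_mem`). For `n = 0`, constant terms and linear coefficients simply multiply.

Lower bound: given a target `p`, fix `q = (1, x + x ^ (s + 1))` and solve `q * r = r * q * p` for `r
= (l, m)`. This is a conjugacy equation for `m` (`exists_conj`), then a linear equation for `l`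
(`exists_subst_eq_mul`). To first order both send `x ^ j` to `κ j * x ^ (j + s)`; characteristic `0`
makes `κ j` nonzero in the relevant range, so coefficients can be solved for one at a time
(`exists_eq_zero_of_approx`). -/

/-! ### Orders of vanishing under substitution -/

theorem X_pow_dvd_subst_sub_subst {P Q : PowerSeries K} (hP : constantCoeff P = 0)
    (hQ : constantCoeff Q = 0) {j : ℕ} (h : X ^ j ∣ P - Q) (f : PowerSeries K) :
    X ^ j ∣ (f.subst P - f.subst Q : PowerSeries K) := by
  rw [X_pow_dvd_iff]
  intro n hn
  rw [map_sub, coeff_subst_eq_sum hP f n.lt_succ_self, coeff_subst_eq_sum hQ f n.lt_succ_self,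
    ← Finset.sum_sub_distrib]
  refine Finset.sum_eq_zero fun k _ => ?_
  rw [← sub_mul, ← map_sub, X_pow_dvd_iff.1 (h.trans (sub_dvd_pow_sub_pow P Q k)) n hn, zero_mul]

theorem X_pow_dvd_subst {P : PowerSeries K} (hP : constantCoeff P = 0) {j : ℕ}
    {f : PowerSeries K} (h : X ^ j ∣ f) : X ^ j ∣ (f.subst P : PowerSeries K) := by
  obtain ⟨e, rfl⟩ := h
  have hs := HasSubst.of_constantCoeff_zero' hP
  rw [subst_mul hs, subst_pow hs, subst_X hs]
  exact (pow_dvd_pow_of_dvd (X_dvd_iff.2 hP) j).mul_right _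

theorem subst_X_self (f : PowerSeries K) : (f.subst (X : PowerSeries K) : PowerSeries K) = f := by
  rw [← map_algebraMap_eq_subst_X, Algebra.algebraMap_self, PowerSeries.map_id, id]

theorem X_pow_dvd_of_subst {P : PowerSeries K} (hP : constantCoeff P = 0) (hP' : coeff 1 P ≠ 0)
    {j : ℕ} {f : PowerSeries K} (h : X ^ j ∣ (f.subst P : PowerSeries K)) : X ^ j ∣ f := by
  have h0 := constantCoeff_substInvOfIsUnit P hP'.isUnit
  have := X_pow_dvd_subst h0 h
  rwa [subst_comp_subst_apply (HasSubst.of_constantCoeff_zero' hP)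
    (HasSubst.of_constantCoeff_zero' h0), subst_substInvOfIsUnit_right P hP hP'.isUnit,
    subst_X_self] at this

theorem constantCoeff_eq_zero_of_dvd_sub {P Q : PowerSeries K} {j : ℕ} (hj : 1 ≤ j)
    (h : X ^ j ∣ P - Q) (hQ : constantCoeff Q = 0) : constantCoeff P = 0 := by
  have := X_dvd_iff.1 ((dvd_pow_self X (by omega : j ≠ 0)).trans h)
  rwa [map_sub, hQ, sub_zero] at this

/-- First-order expansion of the substitution of two close series tangent to the identity. -/
theorem X_pow_dvd_subst_sub_subst_sub {P Q : PowerSeries K} (hP : X ^ 2 ∣ P - X)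
    (hQ : X ^ 2 ∣ Q - X) {j : ℕ} (h : X ^ j ∣ P - Q) (s : ℕ) (w : PowerSeries K) :
    X ^ (j + s + 1) ∣ ((X ^ (s + 1) * w).subst P - (X ^ (s + 1) * w).subst Q -
      C ((s + 1 : K) * coeff j (P - Q) * constantCoeff w) * X ^ (j + s) : PowerSeries K) := by
  have hP0 := constantCoeff_eq_zero_of_dvd_sub one_le_two hP constantCoeff_X
  have hQ0 := constantCoeff_eq_zero_of_dvd_sub one_le_two hQ constantCoeff_X
  have hsP := HasSubst.of_constantCoeff_zero' hP0
  have hsQ := HasSubst.of_constantCoeff_zero' hQ0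
  obtain ⟨z, hz⟩ := X_pow_dvd_subst_sub_subst hP0 hQ0 h w
  obtain ⟨e, he⟩ := h
  obtain ⟨P', hP'⟩ := hP
  obtain ⟨Q', hQ'⟩ := hQ
  have hPX : P = X * (1 + X * P') := by linear_combination hP'
  have hQX : Q = X * (1 + X * Q') := by linear_combination hQ'
  have hce : coeff j (P - Q) = constantCoeff e := by
    rw [he]; simpa using coeff_X_pow_mul e j 0
  -- The geometric sum plays the role of the derivative of `x ^ (s + 1)`; its `s + 1` terms all have
  -- constant term `1`.
  set S : PowerSeries K := ∑ i ∈ Finset.range (s + 1), (1 + X * P') ^ i * (1 + X * Q') ^ (s + 1 - 1 - i)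
    with hS
  have hS0 : constantCoeff S = s + 1 := by simp [hS]
  have hSP : P ^ (s + 1) - Q ^ (s + 1) = X ^ (j + s) * (e * S) := by
    have h1 := (Commute.all (1 + X * P') (1 + X * Q')).geom_sum₂_mul (s + 1)
    rw [← hS] at h1
    have h2 : X * ((1 + X * P') - (1 + X * Q')) = X ^ j * e := by
      rw [← he, hPX, hQX]; ring
    calc P ^ (s + 1) - Q ^ (s + 1)
        = X ^ (s + 1) * ((1 + X * P') ^ (s + 1) - (1 + X * Q') ^ (s + 1)) := by
          rw [mul_sub, ← mul_pow, ← mul_pow, ← hPX, ← hQX]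
      _ = X ^ s * (X * ((1 + X * P') - (1 + X * Q'))) * S := by rw [← h1]; ring
      _ = _ := by rw [h2]; ring
  obtain ⟨y, hy⟩ : X ∣ e * S * (w.subst P : PowerSeries K) -
      C ((s + 1 : K) * coeff j (P - Q) * constantCoeff w) := by
    rw [X_dvd_iff, map_sub, map_mul, map_mul, hS0, constantCoeff_subst_eq hP0, constantCoeff_C, hce]
    ring
  refine ⟨y + (1 + X * Q') ^ (s + 1) * z, ?_⟩
  rw [subst_mul hsP, subst_mul hsQ, subst_pow hsP, subst_pow hsQ, subst_X hsP, subst_X hsQ]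
  have hQs : Q ^ (s + 1) = X ^ (s + 1) * (1 + X * Q') ^ (s + 1) := by rw [← mul_pow, ← hQX]
  linear_combination (w.subst P : PowerSeries K) * hSP + Q ^ (s + 1) * hz + X ^ (j + s) * hy
    + X ^ j * z * hQs

/-! ### Solving equations coefficient by coefficient -/

/-- Successive approximation for a map that is, to first order, `x ^ j ↦ κ j * x ^ (j + s)`. -/
theorem exists_eq_zero_of_approx (F : PowerSeries K → PowerSeries K) (f₀ : PowerSeries K)
    (N s : ℕ) (κ : ℕ → K) (hκ : ∀ j, N ≤ j → κ j ≠ 0) (h₀ : X ^ (N + s) ∣ F f₀)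
    (hF : ∀ j, N ≤ j → ∀ f g, X ^ N ∣ f - f₀ → X ^ j ∣ g →
      X ^ (j + s + 1) ∣ F (f + g) - F f - C (κ j * coeff j g) * X ^ (j + s)) :
    ∃ f, X ^ N ∣ f - f₀ ∧ F f = 0 := by
  -- The correction in degree `N + k` is chosen to cancel the coefficient of `F (u k)` in degree `N
  -- + k + s`.
  obtain ⟨u, hu0, hu⟩ : ∃ u : ℕ → PowerSeries K, u 0 = f₀ ∧ ∀ k, u (k + 1) =
      u k + C (-(κ (N + k))⁻¹ * coeff (N + k + s) (F (u k))) * X ^ (N + k) :=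
    ⟨fun k => Nat.rec f₀ (fun k v =>
      v + C (-(κ (N + k))⁻¹ * coeff (N + k + s) (F v)) * X ^ (N + k)) k, rfl, fun _ => rfl⟩
  have hdvd : ∀ k i, X ^ (N + k) ∣ u (k + i) - u k := by
    intro k i
    induction i with
    | zero => simp
    | succ i ih =>
      rw [← add_assoc, hu, add_sub_right_comm]
      exact ih.add ((pow_dvd_pow X (by omega)).mul_left _)
  have hu₀ : ∀ k, X ^ N ∣ u k - f₀ := fun k => by simpa [hu0] using hdvd 0 k
  have happ : ∀ k, X ^ (N + k + s) ∣ F (u k) := by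
    intro k
    induction k with
    | zero => simpa [hu0] using h₀
    | succ k ih =>
      have h1 := hF (N + k) (by omega) (u k)
        (C (-(κ (N + k))⁻¹ * coeff (N + k + s) (F (u k))) * X ^ (N + k)) (hu₀ k)
        (dvd_mul_left _ _)
      rw [← hu] at h1
      have h2 : X ^ (N + k + s + 1) ∣
          F (u k) - C (coeff (N + k + s) (F (u k))) * X ^ (N + k + s) := by
        rw [X_pow_dvd_iff]
        intro m hm
        rw [map_sub, coeff_C_mul, coeff_X_pow]
        split_ifs with hms
        · rw [hms, mul_one, sub_self]
        · rw [X_pow_dvd_iff.1 ih m (by omega), mul_zero, sub_zero]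
      have h3 := h1.add h2
      rw [coeff_C_mul, coeff_X_pow_self, mul_one, ← mul_assoc, mul_neg,
        mul_inv_cancel₀ (hκ _ (by omega))] at h3
      convert h3 using 1
      · ring
      · simp
  obtain ⟨f, hfc⟩ : ∃ f : PowerSeries K, ∀ i, coeff i f = coeff i (u (i + 1)) :=
    ⟨PowerSeries.mk fun i => coeff i (u (i + 1)), fun i => coeff_mk _ _⟩
  have hf : ∀ k, X ^ (N + k) ∣ f - u k := by
    intro k
    rw [X_pow_dvd_iff]
    intro m hm
    rw [map_sub, hfc, sub_eq_zero]
    rcases le_total (m + 1) k with h | h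
    · obtain ⟨i, rfl⟩ := Nat.exists_eq_add_of_le h
      have := X_pow_dvd_iff.1 (hdvd (m + 1) i) m (by omega)
      rw [map_sub, sub_eq_zero] at this
      exact this.symm
    · obtain ⟨i, hi⟩ := Nat.exists_eq_add_of_le h
      have := X_pow_dvd_iff.1 (hdvd k i) m hm
      rwa [← hi, map_sub, sub_eq_zero] at this
  refine ⟨f, by simpa [hu0] using hf 0, ?_⟩
  ext i
  -- Here `hF` serves as continuity: the limit inherits the vanishing order of `F (u (i + 1))`.
  have h1 := hF (N + i + 1) (by omega) (u (i + 1)) (f - u (i + 1)) (hu₀ _) (hf _)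
  rw [add_sub_cancel] at h1
  have h2 : X ^ (N + i + 1 + s) ∣ F f := by
    have h3 := ((pow_dvd_pow X (Nat.le_succ _)).trans h1).add
      ((happ (i + 1)).add (dvd_mul_left (X ^ (N + i + 1 + s))
        (C (κ (N + i + 1) * coeff (N + i + 1) (f - u (i + 1))))))
    convert h3 using 1
    ring
  exact X_pow_dvd_iff.1 h2 i (by omega)

/-! ### The two functional equations -/

/-- The factor by which `g ↦ g(x + x ^ (s + 1)) - g` multiplies a leading term of degree `j`. -/
def shiftFactor (K : Type*) [Field K] (s j : ℕ) : K := if s = 0 then 2 ^ j - 1 else j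

theorem X_pow_dvd_subst_X_add_X_pow_sub (s : ℕ) {j : ℕ} (hj : 1 ≤ j) {g : PowerSeries K}
    (hg : X ^ j ∣ g) :
    X ^ (j + s + 1) ∣ (g.subst (X + X ^ (s + 1) : PowerSeries K) - g -
      C (shiftFactor K s j * coeff j g) * X ^ (j + s) : PowerSeries K) := by
  obtain ⟨e, rfl⟩ := hg
  have hc : coeff j (X ^ j * e) = constantCoeff e := by simpa using coeff_X_pow_mul e j 0
  rw [hc]
  rcases Nat.eq_zero_or_pos s with rfl | hs
  · have hh : (X + X ^ (0 + 1) : PowerSeries K) = C 2 * X := by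
      rw [map_ofNat]; ring
    have h0 : constantCoeff (C 2 * X : PowerSeries K) = 0 := by simp
    have hsub := HasSubst.of_constantCoeff_zero' h0
    rw [hh, subst_mul hsub, subst_pow hsub, subst_X hsub, shiftFactor, if_pos rfl]
    obtain ⟨y, hy⟩ : X ∣ C (2 ^ j) * (e.subst (C 2 * X : PowerSeries K) : PowerSeries K) - e -
        C ((2 ^ j - 1) * constantCoeff e) := by
      rw [X_dvd_iff, map_sub, map_sub, map_mul, constantCoeff_subst_eq h0, constantCoeff_C,
        constantCoeff_C]
      ring
    refine ⟨y, ?_⟩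
    rw [mul_pow, ← map_pow]
    linear_combination X ^ j * hy
  · obtain ⟨i, rfl⟩ := Nat.exists_eq_add_of_le' hj
    have h2 : (X ^ 2 : PowerSeries K) ∣ X + X ^ (s + 1) - X := by
      rw [add_sub_cancel_left]; exact pow_dvd_pow X (by omega)
    have h := X_pow_dvd_subst_sub_subst_sub h2 (by simp) (j := s + 1) (Q := X) (by simp) i e
    rw [subst_X_self, add_sub_cancel_left, coeff_X_pow_self] at h
    rw [shiftFactor, if_neg (by omega)]
    convert h using 1
    · ring
    · push_cast
      rw [mul_one]
      ring

theorem exists_subst_eq_mul [CharZero K] (s : ℕ) {a : ℕ} (ha : 1 ≤ a) {E : PowerSeries K}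
    (hE : X ^ (a + s) ∣ E - 1) :
    ∃ l : PowerSeries K, X ^ a ∣ l - 1 ∧
      (l.subst (X + X ^ (s + 1) : PowerSeries K) : PowerSeries K) = l * E := by
  have h0 : constantCoeff (X + X ^ (s + 1) : PowerSeries K) = 0 := by simp
  have hsub := HasSubst.of_constantCoeff_zero' h0
  refine (exists_eq_zero_of_approx
    (fun l => (l.subst (X + X ^ (s + 1) : PowerSeries K) : PowerSeries K) - l * E) 1 a s
    (shiftFactor K s) ?_ ?_ ?_).imp fun l hl => ⟨hl.1, sub_eq_zero.1 hl.2⟩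
  · intro j hj
    rw [shiftFactor]
    split_ifs
    · rw [sub_ne_zero]
      exact_mod_cast (Nat.one_lt_two_pow (by omega)).ne'
    · exact_mod_cast (by omega : j ≠ 0)
  · have h1 : ((1 : PowerSeries K).subst (X + X ^ (s + 1) : PowerSeries K) : PowerSeries K) = 1 := by
      rw [← coe_substAlgHom hsub, map_one]
    simp only [h1, one_mul]
    rwa [dvd_sub_comm]
  · intro j hj f g _ hg
    have h1 := X_pow_dvd_subst_X_add_X_pow_sub s (by omega) hg
    -- Since `a ≥ 1`, replacing `E` by `1` does not affect the leading term.
    have h2 : X ^ (j + s + 1) ∣ g * (E - 1) :=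
      (pow_dvd_pow X (by omega : j + s + 1 ≤ j + (a + s))).trans
        (by rw [pow_add]; exact mul_dvd_mul hg hE)
    convert h1.sub h2 using 1
    simp only [subst_add hsub]
    ring

/-- Linearizing in `m`, the left side contributes `shiftFactor K s j` and the right side `s + 1`.
For `s ≥ 1` the difference `j - (s + 1)` vanishes at `j = s + 1`, so the corrections start at degree
`s + 2`; this is why `G` must agree with `x + x ^ (s + 1)` up to order `(s + 2) + s`. -/
theorem exists_conj [CharZero K] (s : ℕ) {G : PowerSeries K}
    (hG : X ^ (2 * (s + 1)) ∣ G - (X + X ^ (s + 1))) :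
    ∃ m : PowerSeries K, X ^ (s + 2) ∣ m - X ∧
      (m.subst (X + X ^ (s + 1) : PowerSeries K) : PowerSeries K) = G.subst m := by
  have h0 : constantCoeff (X + X ^ (s + 1) : PowerSeries K) = 0 := by simp
  have hsub := HasSubst.of_constantCoeff_zero' h0
  obtain ⟨t, ht⟩ := hG
  have hGw : G = X + X ^ (s + 1) * (1 + X ^ (s + 1) * t) := by linear_combination ht
  refine (exists_eq_zero_of_approx
    (fun m => (m.subst (X + X ^ (s + 1) : PowerSeries K) - G.subst m : PowerSeries K))
    X (s + 2) s (fun j => shiftFactor K s j - (s + 1)) ?_ ?_ ?_).imp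
      fun m hm => ⟨hm.1, sub_eq_zero.1 hm.2⟩
  · intro j hj
    rw [sub_ne_zero, shiftFactor]
    split_ifs with h
    · rw [h, Nat.cast_zero, zero_add, Ne, sub_eq_iff_eq_add]
      have : 2 ^ 2 ≤ 2 ^ j := Nat.pow_le_pow_right (by norm_num) (by omega)
      exact_mod_cast (by omega : 2 ^ j ≠ 1 + 1)
    · exact_mod_cast (by omega : j ≠ s + 1)
  · simp only [subst_X hsub, subst_X_self]
    rw [dvd_sub_comm]
    exact ⟨t, by rw [ht]; ring⟩
  · intro j hj f g hf hg
    have hf2 : X ^ 2 ∣ f - X := (pow_dvd_pow X (by omega)).trans hf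
    have hfg2 : X ^ 2 ∣ f + g - X := by
      rw [add_sub_right_comm]
      exact hf2.add ((pow_dvd_pow X (by omega)).trans hg)
    have hf0 := HasSubst.of_constantCoeff_zero'
      (constantCoeff_eq_zero_of_dvd_sub one_le_two hf2 constantCoeff_X)
    have hfg0 := HasSubst.of_constantCoeff_zero'
      (constantCoeff_eq_zero_of_dvd_sub one_le_two hfg2 constantCoeff_X)
    have h1 := X_pow_dvd_subst_X_add_X_pow_sub s (by omega) hg
    have h2 := X_pow_dvd_subst_sub_subst_sub hfg2 hf2 (j := j) (by simpa using hg) s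
      (1 + X ^ (s + 1) * t)
    have hw : constantCoeff (1 + X ^ (s + 1) * t) = 1 := by simp
    rw [add_sub_cancel_left, hw, mul_one] at h2
    convert h1.sub h2 using 1
    simp only [subst_add hsub]
    rw [hGw, subst_add hf0, subst_add hfg0, subst_X hf0, subst_X hfg0, sub_mul, map_sub]
    ring

/-! ### Congruence subgroups and the upper bound -/

/-- `(d, h)` and `(l, m)` agree modulo `x ^ A` and `x ^ B` respectively. -/
def Congr (A B : ℕ) (p q : Riordan K) : Prop := X ^ A ∣ p.d - q.d ∧ X ^ B ∣ p.h - q.h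

theorem Congr.symm {A B : ℕ} {p q : Riordan K} (h : Congr A B p q) : Congr A B q p :=
  ⟨(dvd_sub_comm).1 h.1, (dvd_sub_comm).1 h.2⟩

theorem Congr.trans {A B : ℕ} {p q r : Riordan K} (h : Congr A B p q) (h' : Congr A B q r) :
    Congr A B p r :=
  ⟨by simpa using h.1.add h'.1, by simpa using h.2.add h'.2⟩

/-- Multiplying by a unit and substituting a series of order `1` preserve orders of vanishing. This
yields the subgroup axioms and reduces commutators to comparing two products. -/
theorem congr_mul_right_iff {A B : ℕ} {s p : Riordan K} :
    Congr A B (s * p) s ↔ Congr A B p 1 := by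
  have hd : (s * p).d - s.d = s.d * (p.d - 1).subst s.h := by
    rw [mul_d, subst_sub s.hasSubst, ← coe_substAlgHom s.hasSubst, map_one]
    ring
  have hh : (s * p).h - s.h = (p.h - X).subst s.h := by
    rw [mul_h, subst_sub s.hasSubst, subst_X s.hasSubst]
  have hu : IsUnit s.d := isUnit_iff_constantCoeff.2 s.constantCoeff_d.isUnit
  rw [Congr, Congr, hd, hh, hu.dvd_mul_left, one_d, one_h]
  exact and_congr
    ⟨X_pow_dvd_of_subst s.constantCoeff_h s.coeff_one_h, X_pow_dvd_subst s.constantCoeff_h⟩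
    ⟨X_pow_dvd_of_subst s.constantCoeff_h s.coeff_one_h, X_pow_dvd_subst s.constantCoeff_h⟩

/-- The subgroup of pairs `(d, h)` with `d ∈ 1 + x ^ A K[[x]]` and `h ∈ x + x ^ B K[[x]]`. -/
def congrSubgroup (K : Type*) [Field K] (A B : ℕ) : Subgroup (Riordan K) where
  carrier := {p | Congr A B p 1}
  one_mem' := ⟨by simp, by simp⟩
  mul_mem' hp hq := (congr_mul_right_iff.2 hq).trans hp
  inv_mem' {p} hp := by
    have := congr_mul_right_iff (s := p⁻¹).2 hp
    rw [inv_mul_cancel] at this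
    exact this.symm

theorem mem_congrSubgroup {A B : ℕ} {p : Riordan K} :
    p ∈ congrSubgroup K A B ↔ X ^ A ∣ p.d - 1 ∧ X ^ B ∣ p.h - X := Iff.rfl

theorem commutatorElement_mem_congrSubgroup {A B : ℕ} {p q : Riordan K}
    (h : Congr A B (p⁻¹ * q⁻¹) (q⁻¹ * p⁻¹)) : ⁅p, q⁆ ∈ congrSubgroup K A B := by
  refine congr_mul_right_iff (s := q⁻¹ * p⁻¹).1 ?_
  convert h using 1
  rw [commutatorElement_def]
  group

theorem congr_mul_comm (p q : Riordan K) : Congr 1 2 (p * q) (q * p) := by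
  constructor
  · rw [pow_one, X_dvd_iff, map_sub, mul_d, mul_d, map_mul, map_mul,
      constantCoeff_subst_eq p.constantCoeff_h, constantCoeff_subst_eq q.constantCoeff_h]
    ring
  · rw [X_pow_dvd_iff]
    intro m hm
    rw [mul_h, mul_h, map_sub]
    interval_cases m
    · rw [coeff_zero_eq_constantCoeff_apply, coeff_zero_eq_constantCoeff_apply,
        constantCoeff_subst_eq p.constantCoeff_h, constantCoeff_subst_eq q.constantCoeff_h,
        p.constantCoeff_h, q.constantCoeff_h, sub_self]
    · rw [coeff_one_subst_eq p.constantCoeff_h, coeff_one_subst_eq q.constantCoeff_h]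
      ring

theorem X_pow_dvd_subst_sub_self {f h : PowerSeries K} {i s : ℕ} (hs : 1 ≤ s)
    (hf : X ^ (i + 1) ∣ f - 1) (hh : X ^ (s + 1) ∣ h - X) :
    X ^ (i + 1 + s) ∣ (f.subst h - f : PowerSeries K) := by
  obtain ⟨w, hw⟩ := hf
  have hh2 : X ^ 2 ∣ h - X := (pow_dvd_pow X (by omega)).trans hh
  have hsub := HasSubst.of_constantCoeff_zero'
    (constantCoeff_eq_zero_of_dvd_sub one_le_two hh2 constantCoeff_X)
  have h1 := X_pow_dvd_subst_sub_subst_sub hh2 (by simp) hh i w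
  rw [subst_X_self] at h1
  have h2 := ((pow_dvd_pow X (Nat.le_succ _)).trans h1).add
    (dvd_mul_left (X ^ (s + 1 + i)) (C ((i + 1 : K) * coeff (s + 1) (h - X) * constantCoeff w)))
  rw [← hw, subst_sub hsub, ← coe_substAlgHom hsub, map_one, coe_substAlgHom hsub] at h2
  convert h2 using 1 <;> ring

theorem congr_mul_comm_of_mem {i s : ℕ} (hs : 1 ≤ s) {p q : Riordan K}
    (hp : p ∈ congrSubgroup K (i + 1) (s + 1)) (hq : q ∈ congrSubgroup K (i + 1) (s + 1)) :
    Congr (i + 1 + s) (2 * (s + 1)) (p * q) (q * p) := by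
  rw [mem_congrSubgroup] at hp hq
  constructor
  · rw [mul_d, mul_d]
    convert ((X_pow_dvd_subst_sub_self hs hq.1 hp.2).mul_left p.d).sub
      ((X_pow_dvd_subst_sub_self hs hp.1 hq.2).mul_left q.d) using 1
    ring
  · obtain ⟨v, hv⟩ := hp.2
    obtain ⟨w, hw⟩ := hq.2
    have hp2 : X ^ 2 ∣ p.h - X := (pow_dvd_pow X (by omega)).trans hp.2
    have hq2 : X ^ 2 ∣ q.h - X := (pow_dvd_pow X (by omega)).trans hq.2
    have h1 := X_pow_dvd_subst_sub_subst_sub hp2 (by simp) hp.2 s w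
    have h2 := X_pow_dvd_subst_sub_subst_sub hq2 (by simp) hq.2 s v
    have hcv : coeff (s + 1) (X ^ (s + 1) * v) = constantCoeff v := by
      simpa using coeff_X_pow_mul v (s + 1) 0
    have hcw : coeff (s + 1) (X ^ (s + 1) * w) = constantCoeff w := by
      simpa using coeff_X_pow_mul w (s + 1) 0
    rw [subst_X_self, hv, hcv, ← hw, subst_sub p.hasSubst, subst_X p.hasSubst] at h1
    rw [subst_X_self, hw, hcw, ← hv, subst_sub q.hasSubst, subst_X q.hasSubst] at h2
    rw [mul_h, mul_h]
    convert h1.sub h2 using 1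
    · ring
    -- The two terms in degree `2 * s + 1` differ only in the order of the leading coefficients, and
    -- cancel.
    · rw [mul_right_comm (s + 1 : K)]
      ring

/-! ### Realizing elements as commutators, and the induction -/

theorem exists_eq_commutator [CharZero K] (s : ℕ) {a : ℕ} (ha : 1 ≤ a) {p : Riordan K}
    (hp : p ∈ congrSubgroup K (a + s) (2 * (s + 1))) :
    ∃ q r : Riordan K, p = q⁻¹ * r⁻¹ * q * r ∧
      (1 ≤ s → q ∈ congrSubgroup K a (s + 1) ∧ r ∈ congrSubgroup K a (s + 1)) := by
  rw [mem_congrSubgroup] at hp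
  have h0 : constantCoeff (X + X ^ (s + 1) : PowerSeries K) = 0 := by simp
  have hsub := HasSubst.of_constantCoeff_zero' h0
  have h1 : coeff 1 (X + X ^ (s + 1) : PowerSeries K) ≠ 0 := by
    rw [map_add, coeff_one_X, coeff_X_pow]
    split_ifs
    · norm_num
    · simp
  have hG : X ^ (2 * (s + 1)) ∣
      (p.h.subst (X + X ^ (s + 1) : PowerSeries K) : PowerSeries K) - (X + X ^ (s + 1)) := by
    have := X_pow_dvd_subst h0 hp.2
    rwa [subst_sub hsub, subst_X hsub] at this
  obtain ⟨m, hm, hm'⟩ := exists_conj s hG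
  have hm2 : X ^ 2 ∣ m - X := (pow_dvd_pow X (by omega)).trans hm
  have hm0 := constantCoeff_eq_zero_of_dvd_sub one_le_two hm2 constantCoeff_X
  have hms := HasSubst.of_constantCoeff_zero' hm0
  have hm1 : coeff 1 m ≠ 0 := by
    have := X_pow_dvd_iff.1 hm2 1 one_lt_two
    rw [map_sub, coeff_one_X, sub_eq_zero] at this
    rw [this]
    exact one_ne_zero
  have hhm : constantCoeff ((X + X ^ (s + 1) : PowerSeries K).subst m : PowerSeries K) = 0 := by
    rw [constantCoeff_subst_eq hm0, h0]
  have hhms := HasSubst.of_constantCoeff_zero' hhm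
  have hE : X ^ (a + s) ∣
      (p.d.subst ((X + X ^ (s + 1) : PowerSeries K).subst m : PowerSeries K) : PowerSeries K) - 1 := by
    have := X_pow_dvd_subst hhm hp.1
    rwa [subst_sub hhms, ← coe_substAlgHom hhms, map_one, coe_substAlgHom hhms] at this
  obtain ⟨l, hl, hl'⟩ := exists_subst_eq_mul s ha hE
  have hl0 : constantCoeff l ≠ 0 := by
    have := X_dvd_iff.1 ((dvd_pow_self X (by omega : a ≠ 0)).trans hl)
    rw [map_sub, map_one, sub_eq_zero] at this
    rw [this]
    exact one_ne_zero
  let q : Riordan K := ⟨1, X + X ^ (s + 1), by simp, h0, h1⟩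
  let r : Riordan K := ⟨l, m, hl0, hm0, hm1⟩
  refine ⟨q, r, ?_, fun hs => ⟨⟨?_, ?_⟩, hl, ?_⟩⟩
  -- Comparing the two components of this identity gives exactly the equations solved by `l` and
  -- `m`.
  · have hqr : q * r = r * q * p := by
      ext1
      · change 1 * (l.subst (X + X ^ (s + 1) : PowerSeries K) : PowerSeries K) =
          l * (1 : PowerSeries K).subst m *
            p.d.subst ((X + X ^ (s + 1) : PowerSeries K).subst m : PowerSeries K)
        rw [hl', ← coe_substAlgHom hms, map_one, one_mul, mul_one]
      · change (m.subst (X + X ^ (s + 1) : PowerSeries K) : PowerSeries K) =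
          p.h.subst ((X + X ^ (s + 1) : PowerSeries K).subst m : PowerSeries K)
        rw [hm', subst_comp_subst_apply hsub hms]
    rw [mul_assoc, hqr]
    group
  · change X ^ a ∣ (1 : PowerSeries K) - 1
    simp
  · change X ^ (s + 1) ∣ X + X ^ (s + 1) - (X : PowerSeries K)
    simp
  · exact (pow_dvd_pow X (by omega)).trans hm

theorem derivedSeries_succ_eq [CharZero K] (n : ℕ) :
    derivedSeries (Riordan K) (n + 1) =
      congrSubgroup K (2 ^ (n + 1) - (n + 1)) (2 ^ (n + 1)) ∧
    ∀ p ∈ derivedSeries (Riordan K) (n + 1),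
      ∃ q ∈ derivedSeries (Riordan K) n, ∃ r ∈ derivedSeries (Riordan K) n,
        p = q⁻¹ * r⁻¹ * q * r := by
  have hlt : n < 2 ^ n := Nat.lt_two_pow_self
  have hA : 2 ^ (n + 1) - (n + 1) = (2 ^ n - n) + (2 ^ n - 1) := by rw [pow_succ]; omega
  have hB : 2 ^ (n + 1) = 2 * ((2 ^ n - 1) + 1) := by rw [pow_succ]; omega
  have hle : derivedSeries (Riordan K) (n + 1) ≤
      congrSubgroup K (2 ^ (n + 1) - (n + 1)) (2 ^ (n + 1)) := by
    rw [derivedSeries_succ, Subgroup.commutator_le]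
    intro p hp q hq
    apply commutatorElement_mem_congrSubgroup
    cases n with
    | zero => exact congr_mul_comm _ _
    | succ n =>
      rw [(derivedSeries_succ_eq n).1] at hp hq
      have h2 : 2 ^ (n + 1) - (n + 1) = (2 ^ (n + 1) - (n + 1) - 1) + 1 := by omega
      have h3 : 2 ^ (n + 1) = (2 ^ (n + 1) - 1) + 1 := by omega
      have hs : 1 ≤ 2 ^ (n + 1) - 1 := by omega
      rw [hA, hB]
      generalize 2 ^ (n + 1) - (n + 1) - 1 = i at h2
      generalize 2 ^ (n + 1) - 1 = s at h3 hs ⊢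
      rw [h2] at hp hq ⊢
      rw [h3] at hp hq
      exact congr_mul_comm_of_mem hs (inv_mem hp) (inv_mem hq)
  have hex : ∀ p ∈ congrSubgroup K (2 ^ (n + 1) - (n + 1)) (2 ^ (n + 1)),
      ∃ q ∈ derivedSeries (Riordan K) n, ∃ r ∈ derivedSeries (Riordan K) n,
        p = q⁻¹ * r⁻¹ * q * r := by
    intro p hp
    rw [hA, hB] at hp
    obtain ⟨q, r, hqr, hmem⟩ := exists_eq_commutator _ (by omega) hp
    cases n with
    | zero => exact ⟨q, by simp, r, by simp, hqr⟩
    | succ n =>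
      have h3 : 2 ^ (n + 1) - 1 + 1 = 2 ^ (n + 1) := by omega
      have hmem := hmem (by omega)
      rw [h3, ← (derivedSeries_succ_eq n).1] at hmem
      exact ⟨q, hmem.1, r, hmem.2, hqr⟩
  refine ⟨le_antisymm hle fun p hp => ?_, fun p hp => hex p (hle hp)⟩
  obtain ⟨q, hq, r, hr, rfl⟩ := hex p hp
  rw [derivedSeries_succ]
  -- `⁅a, b⁆` means `a * b * a⁻¹ * b⁻¹`, so `q⁻¹ * r⁻¹ * q * r` is `⁅q⁻¹, r⁻¹⁆`.
  convert Subgroup.commutator_mem_commutator (inv_mem hq) (inv_mem hr) using 1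
  rw [commutatorElement_def, inv_inv, inv_inv]

end Riordan

theorem mainTheorem1 (K : Type*) [Field K] [CharZero K] (n : ℕ) (hn : 1 ≤ n) :
    (derivedSeries (Riordan K) n : Set (Riordan K)) =
        {p : Riordan K |
          (∃ a : PowerSeries K, p.d = 1 + PowerSeries.X ^ (2 ^ n - n) * a) ∧
          (∃ b : PowerSeries K, p.h = PowerSeries.X + PowerSeries.X ^ (2 ^ n) * b)} ∧
      ∀ p ∈ derivedSeries (Riordan K) n,
        ∃ q ∈ derivedSeries (Riordan K) (n - 1), ∃ r ∈ derivedSeries (Riordan K) (n - 1),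
          p = q⁻¹ * r⁻¹ * q * r := by
  obtain ⟨n, rfl⟩ := Nat.exists_eq_add_of_le' hn
  obtain ⟨h1, h2⟩ := Riordan.derivedSeries_succ_eq (K := K) n
  refine ⟨?_, h2⟩
  rw [h1]
  ext p
  simp only [SetLike.mem_coe, Riordan.mem_congrSubgroup, Set.mem_ofPred_eq, dvd_def, sub_eq_iff_eq_add']
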